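/- Let \[ F = \int_{[1,2]\times[0,1]^2}\int_{[0,1]^3}\frac{x_1-y_1}{\left((x_1-y_1)^2+(x_2-y_2)^2+(x_3-y_3)^2\right)^{3/2}}\,dy\,dx \] be the gravitational force (unit gravitational constant) between two homogeneous unit cubes of unit mass that touch along a common face, in the direction joining their centers. The integrand is Lebesgue integrable over $([1,2]\times[0,1]^2)\times[0,1]^3$, and \[ \begin{aligned} F ={}& -\frac{14}{3}+\frac{2\sqrt2}{3}-\frac{4\sqrt3}{3}+\frac{10\sqrt5}{3}-\frac{2\sqrt6}{3}+\frac{23\log 2}{3}-\frac{4\log 5}{3}\\ &+\frac{10}{3}\log(1+\sqrt2)+\frac{20}{3}\log(1+\sqrt3)-\frac{32}{3}\log(1+\sqrt5)+\frac{8}{3}\log(1+\sqrt6)\\ &-\frac13\log(2+\sqrt5)-\frac23\log(2+\sqrt6)-\frac{10\pi}{9}+8\arctan\frac{1}{2\sqrt6}+\frac43\arctan\frac{2}{\sqrt6}. \end{aligned} \] Moreover, the right-hand side equals Fornberg's expression \[ \begin{aligned} \frac13\Big(&-14+2\sqrt2-4\sqrt3+10\sqrt5-2\sqrt6+26\log 2-2\log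 5+10\log(1+\sqrt2)+20\log(1+\sqrt3)\\ &-35\log(1+\sqrt5)+6\log(1+\sqrt6)-2\log(4+\sqrt6)+\frac{26\pi}{3}-22\arctan(2\sqrt6)\Big). \end{aligned} \] -/

import Mathlib

noncomputable section

namespace TwoCubes

/-- The `j`-th component of the Newtonian `r⁻³` force kernel at the points `x` and `y` of `ℝ³`:
`(x_j - y_j) / ((x₀ - y₀)² + (x₁ - y₁)² + (x₂ - y₂)²)^{3/2}`. -/
def forceKernel (j : Fin 3) (x y : Fin 3 → ℝ) : ℝ :=
  (x j - y j) / ((x 0 - y 0) ^ 2 + (x 1 - y 1) ^ 2 + (x 2 - y 2) ^ 2) ^ (3 / 2 : ℝ)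

/-- The `j`-th component of the Newtonian force between homogeneous bodies of unit density
occupying `Q` and `Q'` (unit gravitational constant), as a sixfold Lebesgue integral. -/
def forceComponent (j : Fin 3) (Q Q' : Set (Fin 3 → ℝ)) : ℝ :=
  ∫ x in Q, ∫ y in Q', forceKernel j x y

/-- The cube `[1,2] × [0,1] × [0,1]`. -/
def cubeRight : Set (Fin 3 → ℝ) := Set.Icc ![1, 0, 0] ![2, 1, 1]

/-- The cube `[0,1] × [0,1] × [0,1]`. -/
def cubeLeft : Set (Fin 3 → ℝ) := Set.Icc ![0, 0, 0] ![1, 1, 1]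

/-- The force between the two touching unit cubes, in the direction joining their centers. -/
def twoCubesForce : ℝ := forceComponent 0 cubeRight cubeLeft

/-- The closed form with logarithms and small-argument arctangents. -/
def closedForm : ℝ :=
  -(14 / 3) + 2 * √2 / 3 - 4 * √3 / 3 + 10 * √5 / 3 - 2 * √6 / 3
    + 23 * Real.log 2 / 3 - 4 * Real.log 5 / 3
    + 10 / 3 * Real.log (1 + √2) + 20 / 3 * Real.log (1 + √3)
    - 32 / 3 * Real.log (1 + √5) + 8 / 3 * Real.log (1 + √6)
    - 1 / 3 * Real.log (2 + √5) - 2 / 3 * Real.log (2 + √6)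
    - 10 * Real.pi / 9 + 8 * Real.arctan (1 / (2 * √6)) + 4 / 3 * Real.arctan (2 / √6)

/-- Fornberg's fourteen-term closed form. -/
def fornbergForm : ℝ :=
  1 / 3 * (-14 + 2 * √2 - 4 * √3 + 10 * √5 - 2 * √6 + 26 * Real.log 2 - 2 * Real.log 5
    + 10 * Real.log (1 + √2) + 20 * Real.log (1 + √3) - 35 * Real.log (1 + √5)
    + 6 * Real.log (1 + √6) - 2 * Real.log (4 + √6)
    + 26 * Real.pi / 3 - 22 * Real.arctan (2 * √6))

end TwoCubes

end

/-!
The kernel depends only on `x - y`, so the force is the integral of `x / r³` over `ℝ³` against the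
volume of the overlap of one cube with a translate of the other. That volume is a product of three
tents `1 - |s|`, centred at `1` in the first coordinate and at `0` in the other two. Integrating by
parts twice, the integral of `f''` against the tent of half-width `h` about `a` is the second
difference `f (a + h) - 2 f a + f (a - h)`. Applying this in each coordinate, the force becomes the
triple second difference at `(1, 0, 0)` of a function whose derivative `∂x² ∂y² ∂z²` is `x / r³`.
Such a function, `-cubeEnergy`, is explicit in terms of inverse hyperbolic sines and arctangents,
and only its values at `x ∈ {0, 1, 2}` and `y, z ∈ {-1, 0, 1}` enter. Since `x / r³ ≥ 0` on the
overlap region, the computation with nonnegative integrals also gives integrability; the singularity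
only requires that the primitives remain continuous across the coordinate planes.
-/

noncomputable section

namespace TwoCubes

open Real Set MeasureTheory

/-! ### Averages against a tent -/

lemma tent_mul_nonneg_ae {g : ℝ → ℝ} {a h : ℝ}
    (hpos : ∀ t ∈ Icc (a - h) (a + h), t ≠ a → 0 ≤ g t) :
    0 ≤ᵐ[volume.restrict (Icc (a - h) (a + h))] fun t => (h - |t - a|) * g t := by
  filter_upwards [ae_restrict_mem measurableSet_Icc,
    ae_restrict_of_ae (Measure.ae_ne volume a)] with t ht hta
  have : |t - a| ≤ h := abs_sub_le_iff.2 ⟨by linarith [ht.2], by linarith [ht.1]⟩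
  exact mul_nonneg (sub_nonneg.2 this) (hpos t ht hta)

lemma second_difference_eq_of_even {f : ℝ → ℝ} (hfe : Function.Even f) (h : ℝ) :
    f (0 + h) - 2 * f 0 + f (0 - h) = 2 * (f h - f 0) := by
  rw [zero_add, zero_sub, hfe h]
  ring

/-- `f` and `f'` are successive primitives of `f''`, the three functions being continuous and
differentiability being waived at the single point `a`. -/
structure IsSecondPrimitive (f f' f'' : ℝ → ℝ) (a : ℝ) : Prop where
  continuous : Continuous f
  continuous_deriv : Continuous f'
  continuous_deriv_deriv : Continuous f''
  hasDerivAt : ∀ t ≠ a, HasDerivAt f (f' t) t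
  hasDerivAt_deriv : ∀ t ≠ a, HasDerivAt f' (f'' t) t

namespace IsSecondPrimitive

variable {f f' f'' g g' g'' : ℝ → ℝ} {a h : ℝ}

lemma const_mul (hf : IsSecondPrimitive f f' f'' a) (c : ℝ) :
    IsSecondPrimitive (fun t => c * f t) (fun t => c * f' t) (fun t => c * f'' t) a where
  continuous := hf.continuous.const_mul c
  continuous_deriv := hf.continuous_deriv.const_mul c
  continuous_deriv_deriv := hf.continuous_deriv_deriv.const_mul c
  hasDerivAt t ht := (hf.hasDerivAt t ht).const_mul c
  hasDerivAt_deriv t ht := (hf.hasDerivAt_deriv t ht).const_mul c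

lemma sub (hf : IsSecondPrimitive f f' f'' a) (hg : IsSecondPrimitive g g' g'' a) :
    IsSecondPrimitive (fun t => f t - g t) (fun t => f' t - g' t) (fun t => f'' t - g'' t) a where
  continuous := hf.continuous.sub hg.continuous
  continuous_deriv := hf.continuous_deriv.sub hg.continuous_deriv
  continuous_deriv_deriv := hf.continuous_deriv_deriv.sub hg.continuous_deriv_deriv
  hasDerivAt t ht := (hf.hasDerivAt t ht).sub (hg.hasDerivAt t ht)
  hasDerivAt_deriv t ht := (hf.hasDerivAt_deriv t ht).sub (hg.hasDerivAt_deriv t ht)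

lemma integral_sub_mul (hf : IsSecondPrimitive f f' f'' a) (b : ℝ) :
    ∫ t in a..b, (b - t) * f'' t = f b - f a - (b - a) * f' a := by
  have hderiv : ∀ t ≠ a, HasDerivAt (fun t => (b - t) * f' t + f t) ((b - t) * f'' t) t :=
    fun t ht => ((((hasDerivAt_id t).const_sub b).mul (hf.hasDerivAt_deriv t ht)).add
      (hf.hasDerivAt t ht)).congr_deriv (by simp only [id]; ring)
  have hcont := hf.continuous
  have hcont' := hf.continuous_deriv
  have hcont'' := hf.continuous_deriv_deriv
  rw [intervalIntegral.integral_eq_sub_of_hasDeriv_right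
    (f := fun t => (b - t) * f' t + f t) (by fun_prop)
    (fun t ht => (hderiv t ?_).hasDerivWithinAt)
    (Continuous.intervalIntegrable (by fun_prop) _ _)]
  · ring
  · rintro rfl
    rcases le_total t b with htb | hbt
    · exact ht.1.ne (min_eq_left htb)
    · exact ht.2.ne (max_eq_left hbt).symm

lemma integral_tent_mul (hf : IsSecondPrimitive f f' f'' a) (hh : 0 ≤ h) :
    ∫ t in (a - h)..(a + h), (h - |t - a|) * f'' t = f (a + h) - 2 * f a + f (a - h) := by
  have hcont := hf.continuous_deriv_deriv
  have hright : ∫ t in a..(a + h), (h - |t - a|) * f'' t = f (a + h) - f a - h * f' a := by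
    have := hf.integral_sub_mul (a + h)
    rw [add_sub_cancel_left] at this
    rw [← this]
    refine intervalIntegral.integral_congr fun t ht => ?_
    rw [uIcc_of_le (by linarith)] at ht
    simp only [abs_of_nonneg (sub_nonneg.2 ht.1)]
    ring
  have hleft : ∫ t in (a - h)..a, (h - |t - a|) * f'' t = f (a - h) - f a + h * f' a := by
    have := hf.integral_sub_mul (a - h)
    rw [sub_sub_cancel_left, neg_mul, sub_neg_eq_add] at this
    rw [← this, intervalIntegral.integral_symm a, ← intervalIntegral.integral_neg]
    refine intervalIntegral.integral_congr fun t ht => ?_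
    rw [uIcc_of_ge (by linarith)] at ht
    simp only [abs_of_nonpos (sub_nonpos.2 ht.2)]
    ring
  rw [← intervalIntegral.integral_add_adjacent_intervals (b := a)
    (Continuous.intervalIntegrable (by fun_prop) _ _)
    (Continuous.intervalIntegrable (by fun_prop) _ _), hleft, hright]
  ring

lemma second_difference_nonneg (hf : IsSecondPrimitive f f' f'' a) (hh : 0 ≤ h)
    (hpos : ∀ t ∈ Icc (a - h) (a + h), t ≠ a → 0 ≤ f'' t) :
    0 ≤ f (a + h) - 2 * f a + f (a - h) := by
  rw [← hf.integral_tent_mul hh]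
  exact intervalIntegral.integral_nonneg_of_ae_restrict (by linarith) (tent_mul_nonneg_ae hpos)

lemma lintegral_tent_mul (hf : IsSecondPrimitive f f' f'' a) (hh : 0 ≤ h)
    (hpos : ∀ t ∈ Icc (a - h) (a + h), t ≠ a → 0 ≤ f'' t) :
    ∫⁻ t, ENNReal.ofReal (h - |t - a|) * ENNReal.ofReal (f'' t)
      = ENNReal.ofReal (f (a + h) - 2 * f a + f (a - h)) := by
  have hcont := hf.continuous_deriv_deriv
  have hsupport : (Function.support fun t =>
      ENNReal.ofReal (h - |t - a|) * ENNReal.ofReal (f'' t)) ⊆ Icc (a - h) (a + h) := by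
    intro t ht
    have hlt : |t - a| < h := by
      simpa using left_ne_zero_of_mul ht
    obtain ⟨hl, hr⟩ := abs_lt.1 hlt
    exact ⟨by linarith, by linarith⟩
  rw [← setLIntegral_eq_of_support_subset hsupport, ← hf.integral_tent_mul hh,
    intervalIntegral.integral_of_le (by linarith), ← integral_Icc_eq_integral_Ioc,
    ofReal_integral_eq_lintegral_ofReal (Continuous.integrableOn_Icc (by fun_prop))
      (tent_mul_nonneg_ae hpos)]
  refine setLIntegral_congr_fun measurableSet_Icc fun t ht => ?_
  have : |t - a| ≤ h := abs_sub_le_iff.2 ⟨by linarith [ht.2], by linarith [ht.1]⟩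
  exact (ENNReal.ofReal_mul (sub_nonneg.2 this)).symm

lemma lintegral_tent_mul_of_even (hf : IsSecondPrimitive f f' f'' 0) (hfe : Function.Even f)
    (hpos : ∀ t ≠ 0, 0 ≤ f'' t) :
    ∫⁻ t, ENNReal.ofReal (1 - |t|) * ENNReal.ofReal (f'' t)
      = ENNReal.ofReal (2 * (f 1 - f 0)) := by
  simpa only [sub_zero, second_difference_eq_of_even hfe] using
    hf.lintegral_tent_mul zero_le_one fun t _ => hpos t

lemma two_mul_sub_nonneg_of_even (hf : IsSecondPrimitive f f' f'' 0) (hfe : Function.Even f)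
    (hpos : ∀ t ≠ 0, 0 ≤ f'' t) : 0 ≤ 2 * (f 1 - f 0) := by
  simpa only [second_difference_eq_of_even hfe] using
    hf.second_difference_nonneg zero_le_one fun t _ => hpos t

end IsSecondPrimitive

/-! ### Potentials of rods, plates and cubes -/

/-- The Euclidean norm of `(x, y, z)`. -/
def radius (x y z : ℝ) : ℝ := √(x ^ 2 + y ^ 2 + z ^ 2)

/-- The Newtonian potential `∫ dt / r` of the rod `[0, x]` at distance `√(y² + z²)` from its
end `0`; it vanishes by convention on the line `y = z = 0`. -/
def rodPotential (x y z : ℝ) : ℝ := arsinh (x / √(y ^ 2 + z ^ 2))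

/-- The solid angle under which the rectangle with opposite vertices `(x, 0, 0)` and `(x, y, z)`
is seen from the origin; it vanishes by convention for `x = 0`. -/
def solidAngle (x y z : ℝ) : ℝ := arctan (y * z / (x * radius x y z))

variable {x y z : ℝ}

lemma sq_radius (x y z : ℝ) : radius x y z ^ 2 = x ^ 2 + y ^ 2 + z ^ 2 := sq_sqrt (by positivity)

lemma radius_swap (x y z : ℝ) : radius y x z = radius x y z := by
  simp only [radius, add_comm (y ^ 2)]

lemma radius_swap_right (x y z : ℝ) : radius x z y = radius x y z := by
  simp only [radius, add_right_comm]

lemma radius_rotate (x y z : ℝ) : radius z x y = radius x y z := by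
  rw [radius_swap, radius_swap_right]

lemma radius_pos (h : 0 < y ^ 2 + z ^ 2) : 0 < radius x y z :=
  sqrt_pos.2 (by linarith [sq_nonneg x])

lemma rodPotential_swap (x y z : ℝ) : rodPotential x z y = rodPotential x y z := by
  simp only [rodPotential, add_comm]

lemma solidAngle_swap (x y z : ℝ) : solidAngle x z y = solidAngle x y z := by
  simp only [solidAngle, radius_swap_right, mul_comm]

lemma hasDerivAt_radius_first (h : 0 < radius x y z) :
    HasDerivAt (fun t => radius t y z) (x / radius x y z) x := by
  have hsq : HasDerivAt (fun t => t ^ 2 + y ^ 2 + z ^ 2) (2 * x) x := by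
    simpa using ((hasDerivAt_pow 2 x).add_const (y ^ 2)).add_const (z ^ 2)
  exact (hsq.sqrt (sqrt_pos.1 h).ne').congr_deriv (mul_div_mul_left _ _ two_ne_zero)

lemma hasDerivAt_radius_middle (h : 0 < radius x y z) :
    HasDerivAt (fun t => radius x t z) (y / radius x y z) y := by
  simpa only [radius_swap] using
    hasDerivAt_radius_first (x := y) (y := x) (z := z) (by rwa [radius_swap])

lemma hasDerivAt_radius_last (h : 0 < radius x y z) :
    HasDerivAt (fun t => radius x y t) (z / radius x y z) z := by
  simpa only [radius_rotate] using
    hasDerivAt_radius_first (x := z) (y := x) (z := y) (by rwa [radius_rotate])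

lemma radius_eq_sqrt_mul_sqrt (h : 0 < y ^ 2 + z ^ 2) :
    radius x y z = √(y ^ 2 + z ^ 2) * √(1 + (x / √(y ^ 2 + z ^ 2)) ^ 2) := by
  rw [← sqrt_mul h.le, radius, div_pow, sq_sqrt h.le, mul_add, mul_div_cancel₀ _ h.ne']
  ring_nf

lemma hasDerivAt_rodPotential_first (h : 0 < y ^ 2 + z ^ 2) :
    HasDerivAt (fun t => rodPotential t y z) (1 / radius x y z) x := by
  refine ((hasDerivAt_id x).div_const √(y ^ 2 + z ^ 2)).arsinh.congr_deriv ?_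
  simp only [radius_eq_sqrt_mul_sqrt h, id, smul_eq_mul]
  field_simp

lemma hasDerivAt_rodPotential_middle (h : 0 < y ^ 2 + z ^ 2) :
    HasDerivAt (fun t => rodPotential x t z) (-(x * y) / (radius x y z * (y ^ 2 + z ^ 2))) y := by
  have hsq : HasDerivAt (fun t => t ^ 2 + z ^ 2) (2 * y) y := by
    simpa using (hasDerivAt_pow 2 y).add_const (z ^ 2)
  have hs := sqrt_pos.2 h
  refine (((hasDerivAt_const y x).div (hsq.sqrt h.ne') hs.ne').arsinh).congr_deriv ?_
  rw [radius_eq_sqrt_mul_sqrt h, ← sq_sqrt h.le, sqrt_sq hs.le]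
  simp only [Pi.div_apply, smul_eq_mul]
  have hw : 0 < √(1 + (x / √(y ^ 2 + z ^ 2)) ^ 2) := by positivity
  generalize √(1 + (x / √(y ^ 2 + z ^ 2)) ^ 2) = w at hw ⊢
  field_simp
  ring

lemma hasDerivAt_rodPotential_last (h : 0 < y ^ 2 + z ^ 2) :
    HasDerivAt (fun t => rodPotential x y t) (-(x * z) / (radius x y z * (y ^ 2 + z ^ 2))) z := by
  simp only [rodPotential_swap x _ y]
  rw [radius_swap_right, add_comm]
  exact hasDerivAt_rodPotential_middle (by rwa [add_comm])

lemma hasDerivAt_arctan_div {f g : ℝ → ℝ} {f' g' t : ℝ} (hf : HasDerivAt f f' t)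
    (hg : HasDerivAt g g' t) (h : g t ≠ 0) :
    HasDerivAt (fun s => arctan (f s / g s)) ((f' * g t - f t * g') / (g t ^ 2 + f t ^ 2)) t := by
  refine (hf.div hg h).arctan.congr_deriv ?_
  rw [Pi.div_apply]
  field_simp

lemma sq_mul_radius_add_sq (x y z : ℝ) :
    (x * radius x y z) ^ 2 + (y * z) ^ 2 = (x ^ 2 + y ^ 2) * (x ^ 2 + z ^ 2) := by
  rw [mul_pow, sq_radius]
  ring

lemma hasDerivAt_solidAngle_first (hx : x ≠ 0) :
    HasDerivAt (fun t => solidAngle t y z)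
      (-(y * z / radius x y z) * (1 / (x ^ 2 + y ^ 2) + 1 / (x ^ 2 + z ^ 2))) x := by
  have hr : 0 < radius x y z := sqrt_pos.2 (by positivity)
  refine (hasDerivAt_arctan_div (hasDerivAt_const x (y * z))
    ((hasDerivAt_id x).mul (hasDerivAt_radius_first hr)) (mul_ne_zero hx hr.ne')).congr_deriv ?_
  simp only [Pi.mul_apply, id, sq_mul_radius_add_sq]
  field_simp
  rw [sq_radius]
  ring

/-- The case `x = 0` is included: there both sides vanish. -/
lemma hasDerivAt_solidAngle_middle :
    HasDerivAt (fun t => solidAngle x t z) (x * z / (radius x y z * (x ^ 2 + y ^ 2))) y := by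
  rcases eq_or_ne x 0 with rfl | hx
  · simpa [solidAngle] using hasDerivAt_const y (0 : ℝ)
  have hr : 0 < radius x y z := sqrt_pos.2 (by positivity)
  refine (hasDerivAt_arctan_div ((hasDerivAt_id y).mul_const z)
    ((hasDerivAt_radius_middle hr).const_mul x) (mul_ne_zero hx hr.ne')).congr_deriv ?_
  simp only [id, sq_mul_radius_add_sq]
  field_simp
  rw [sq_radius]
  ring

lemma hasDerivAt_solidAngle_last :
    HasDerivAt (fun t => solidAngle x y t) (x * y / (radius x y z * (x ^ 2 + z ^ 2))) z := by
  simp only [solidAngle_swap x _ y]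
  rw [← radius_swap_right]
  exact hasDerivAt_solidAngle_middle

/-- The Newtonian potential at `(0, y, 0)` of the plate `[0, x] × {0} × [0, z]`: the primitive in
`z` of `rodPotential`. -/
def platePotential (x y z : ℝ) : ℝ :=
  z * rodPotential x y z + x * rodPotential z x y - y * solidAngle y x z

/-- The primitive in `z` of `platePotential`. -/
def plateEnergy (x y z : ℝ) : ℝ :=
  (z ^ 2 - y ^ 2) / 2 * rodPotential x y z + x * z * rodPotential z x y
    - y * z * solidAngle y x z - x * radius x y z / 2

/-- The primitive in `y` of `plateEnergy`, known in micromagnetics as the Newell function `g`. -/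
def newellFunction (x y z : ℝ) : ℝ :=
  (3 * z ^ 2 * y - y ^ 3) / 6 * rodPotential x y z
    + x * (3 * z ^ 2 - x ^ 2) / 6 * rodPotential y x z + x * y * z * rodPotential z x y
    - y ^ 2 * z / 2 * solidAngle y x z - z ^ 3 / 6 * solidAngle z x y
    - x ^ 2 * z / 2 * solidAngle x y z - x * y * radius x y z / 3

/-- The primitive in `y` of `newellFunction`. -/
def cubeEnergy (x y z : ℝ) : ℝ :=
  (6 * y ^ 2 * z ^ 2 - y ^ 4 - z ^ 4) / 24 * rodPotential x y z
    + x * y * (3 * z ^ 2 - x ^ 2) / 6 * rodPotential y x z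
    + x * z * (3 * y ^ 2 - x ^ 2) / 6 * rodPotential z x y
    - y ^ 3 * z / 6 * solidAngle y x z - y * z ^ 3 / 6 * solidAngle z x y
    - x ^ 2 * y * z / 2 * solidAngle x y z
    + x * radius x y z * (2 * x ^ 2 - 3 * y ^ 2 - 3 * z ^ 2) / 24

lemma hasDerivAt_platePotential (hy : y ≠ 0) :
    HasDerivAt (fun t => platePotential x y t) (rodPotential x y z) z := by
  have hr : 0 < radius x y z := sqrt_pos.2 (by positivity)
  have hA := hasDerivAt_rodPotential_last (x := x) (y := y) (z := z) (by positivity)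
  have hC := hasDerivAt_rodPotential_first (x := z) (y := x) (z := y) (by positivity)
  have hβ := hasDerivAt_solidAngle_last (x := y) (y := x) (z := z)
  rw [radius_rotate] at hC
  rw [radius_swap] at hβ
  refine ((((hasDerivAt_id z).mul hA).add (hC.const_mul x)).sub (hβ.const_mul y)).congr_deriv ?_
  simp only [id]
  field_simp
  ring

lemma hasDerivAt_plateEnergy (hy : y ≠ 0) :
    HasDerivAt (fun t => plateEnergy x y t) (platePotential x y z) z := by
  have hr : 0 < radius x y z := sqrt_pos.2 (by positivity)
  have hA := hasDerivAt_rodPotential_last (x := x) (y := y) (z := z) (by positivity)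
  have hC := hasDerivAt_rodPotential_first (x := z) (y := x) (z := y) (by positivity)
  have hβ := hasDerivAt_solidAngle_last (x := y) (y := x) (z := z)
  rw [radius_rotate] at hC
  rw [radius_swap] at hβ
  refine ((((((hasDerivAt_pow 2 z).sub_const (y ^ 2)).div_const 2).mul hA).add
    (((hasDerivAt_id z).const_mul x).mul hC)).sub (((hasDerivAt_id z).const_mul y).mul hβ)).sub
    (((hasDerivAt_radius_last hr).const_mul x).div_const 2) |>.congr_deriv ?_
  simp only [id, platePotential]
  field_simp
  ring

lemma hasDerivAt_newellFunction (hx : x ≠ 0) (hy : y ≠ 0) :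
    HasDerivAt (fun t => newellFunction x t z) (plateEnergy x y z) y := by
  have hr : 0 < radius x y z := sqrt_pos.2 (by positivity)
  have hA := hasDerivAt_rodPotential_middle (x := x) (y := y) (z := z) (by positivity)
  have hB := hasDerivAt_rodPotential_first (x := y) (y := x) (z := z) (by positivity)
  have hC := hasDerivAt_rodPotential_last (x := z) (y := x) (z := y) (by positivity)
  have hα := hasDerivAt_solidAngle_middle (x := x) (y := y) (z := z)
  have hβ := hasDerivAt_solidAngle_first (x := y) (y := x) (z := z) hy
  have hγ := hasDerivAt_solidAngle_last (x := z) (y := x) (z := y)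
  rw [radius_rotate] at hC hγ
  rw [radius_swap] at hB hβ
  refine ((((((((((hasDerivAt_id y).const_mul (3 * z ^ 2)).sub (hasDerivAt_pow 3 y)).div_const 6
    ).mul hA).add (hB.const_mul (x * (3 * z ^ 2 - x ^ 2) / 6))).add
    ((((hasDerivAt_id y).const_mul x).mul_const z).mul hC)).sub
    ((((hasDerivAt_pow 2 y).mul_const z).div_const 2).mul hβ)).sub
    (hγ.const_mul (z ^ 3 / 6))).sub (hα.const_mul (x ^ 2 * z / 2))).sub
    ((((hasDerivAt_id y).const_mul x).mul (hasDerivAt_radius_middle hr)).div_const 3)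
    |>.congr_deriv ?_
  rw [add_comm (y ^ 2) (x ^ 2), add_comm (z ^ 2) (y ^ 2)]
  simp only [id, plateEnergy, Pi.sub_apply]
  field_simp
  linear_combination 6 * x * (x ^ 2 + y ^ 2) * (y ^ 2 + z ^ 2) * sq_radius x y z

lemma hasDerivAt_cubeEnergy (hx : x ≠ 0) (hy : y ≠ 0) :
    HasDerivAt (fun t => cubeEnergy x t z) (newellFunction x y z) y := by
  have hr : 0 < radius x y z := sqrt_pos.2 (by positivity)
  have hA := hasDerivAt_rodPotential_middle (x := x) (y := y) (z := z) (by positivity)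
  have hB := hasDerivAt_rodPotential_first (x := y) (y := x) (z := z) (by positivity)
  have hC := hasDerivAt_rodPotential_last (x := z) (y := x) (z := y) (by positivity)
  have hα := hasDerivAt_solidAngle_middle (x := x) (y := y) (z := z)
  have hβ := hasDerivAt_solidAngle_first (x := y) (y := x) (z := z) hy
  have hγ := hasDerivAt_solidAngle_last (x := z) (y := x) (z := y)
  rw [radius_rotate] at hC hγ
  rw [radius_swap] at hB hβ
  have hid := hasDerivAt_id y
  have hsq := hasDerivAt_pow 2 y
  have hA' := ((((hsq.const_mul 6).mul_const (z ^ 2)).sub (hasDerivAt_pow 4 y)).sub_const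
    (z ^ 4)).div_const 24 |>.mul hA
  have hB' := (((hid.const_mul x).mul_const (3 * z ^ 2 - x ^ 2)).div_const 6).mul hB
  have hC' := (((hsq.const_mul 3).sub_const (x ^ 2)).const_mul (x * z)).div_const 6 |>.mul hC
  have hα' := (((hid.const_mul (x ^ 2)).mul_const z).div_const 2).mul hα
  have hβ' := (((hasDerivAt_pow 3 y).mul_const z).div_const 6).mul hβ
  have hγ' := ((hid.mul_const (z ^ 3)).div_const 6).mul hγ
  have hr' := ((hasDerivAt_radius_middle hr).const_mul x).mul
    (((hsq.const_mul 3).const_sub (2 * x ^ 2)).sub_const (3 * z ^ 2)) |>.div_const 24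
  refine ((((((hA'.add hB').add hC').sub hβ').sub hγ').sub hα').add hr').congr_deriv ?_
  rw [add_comm (y ^ 2) (x ^ 2), add_comm (z ^ 2) (y ^ 2)]
  simp only [id, newellFunction, Pi.sub_apply]
  field_simp
  linear_combination 72 * x * y * (x ^ 2 + y ^ 2) * (y ^ 2 + z ^ 2) * sq_radius x y z

/-! ### Continuity across the coordinate planes -/

lemma continuous_mul_of_bounded {g : ℝ → ℝ} {C : ℝ} (hg : ∀ t ≠ 0, ContinuousAt g t)
    (hC : ∀ t, |g t| ≤ C) : Continuous fun t => t * g t := by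
  refine continuous_iff_continuousAt.2 fun t => ?_
  rcases eq_or_ne t 0 with rfl | ht
  · rw [ContinuousAt, zero_mul]
    exact Filter.tendsto_id.zero_mul_isBoundedUnder_le
      (Filter.isBoundedUnder_of ⟨C, fun t => hC t⟩)
  · exact continuousAt_id.mul (hg t ht)

lemma abs_arsinh_le (t : ℝ) : |arsinh t| ≤ |t| := by
  have harsinh : ∀ s, 0 ≤ s → arsinh s ≤ s := fun s hs => by
    simpa only [sinh_arsinh] using self_le_sinh_iff.2 (arsinh_nonneg_iff.2 hs)
  rcases le_total 0 t with ht | ht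
  · rw [abs_of_nonneg ht, abs_of_nonneg (arsinh_nonneg_iff.2 ht)]
    exact harsinh t ht
  · rw [abs_of_nonpos ht, abs_of_nonpos (arsinh_nonpos_iff.2 ht), ← arsinh_neg]
    exact harsinh (-t) (neg_nonneg.2 ht)

lemma abs_mul_rodPotential_le (x y z : ℝ) : |y * rodPotential x y z| ≤ |x| := by
  have hy : |y| ≤ √(y ^ 2 + z ^ 2) := abs_le_sqrt (by linarith [sq_nonneg z])
  calc |y * rodPotential x y z|
      ≤ √(y ^ 2 + z ^ 2) * |x / √(y ^ 2 + z ^ 2)| := by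
        rw [abs_mul]
        exact mul_le_mul hy (abs_arsinh_le _) (abs_nonneg _) (sqrt_nonneg _)
    _ = |x| * (√(y ^ 2 + z ^ 2) / √(y ^ 2 + z ^ 2)) := by
        rw [abs_div, abs_of_nonneg (sqrt_nonneg _)]
        ring
    _ ≤ |x| := mul_le_of_le_one_right (abs_nonneg x) (div_self_le_one _)

lemma continuous_radius_middle (x z : ℝ) : Continuous fun y => radius x y z := by
  unfold radius
  fun_prop

lemma continuous_mul_mul_rodPotential (x z : ℝ) :
    Continuous fun y => y * (y * rodPotential x y z) := by
  refine continuous_mul_of_bounded (fun y hy => ?_) (abs_mul_rodPotential_le x · z)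
  exact continuousAt_id.mul (hasDerivAt_rodPotential_middle (by positivity)).continuousAt

lemma continuous_const_mul_rodPotential (x z : ℝ) :
    Continuous fun y => z * rodPotential x y z := by
  rcases eq_or_ne z 0 with rfl | hz
  · simpa only [zero_mul] using continuous_const
  · exact continuous_const.mul <| continuous_iff_continuousAt.2 fun y =>
      (hasDerivAt_rodPotential_middle (by positivity)).continuousAt

lemma continuous_mul_solidAngle (x z : ℝ) : Continuous fun y => y * solidAngle y x z :=
  continuous_mul_of_bounded (fun _ hy => (hasDerivAt_solidAngle_first hy).continuousAt)
    fun _ => abs_le.2 ⟨(neg_pi_div_two_lt_arctan _).le, (arctan_lt_pi_div_two _).le⟩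

lemma continuous_rodPotential_first (hy : y ≠ 0) : Continuous fun x => rodPotential x y z :=
  continuous_iff_continuousAt.2 fun _ =>
    (hasDerivAt_rodPotential_first (by positivity)).continuousAt

lemma continuous_rodPotential_last (hy : y ≠ 0) : Continuous fun z => rodPotential x y z :=
  continuous_iff_continuousAt.2 fun _ =>
    (hasDerivAt_rodPotential_last (by positivity)).continuousAt

lemma continuous_solidAngle_middle (x z : ℝ) : Continuous fun y => solidAngle x y z :=
  continuous_iff_continuousAt.2 fun _ => hasDerivAt_solidAngle_middle.continuousAt

lemma continuous_solidAngle_last (x y : ℝ) : Continuous fun z => solidAngle x y z :=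
  continuous_iff_continuousAt.2 fun _ => hasDerivAt_solidAngle_last.continuousAt

lemma continuous_plateEnergy_middle (hx : x ≠ 0) : Continuous fun y => plateEnergy x y z := by
  have hA := continuous_mul_mul_rodPotential x z
  have hA' := continuous_const_mul_rodPotential x z
  have hC := continuous_rodPotential_last (x := z) hx
  have hβ := continuous_mul_solidAngle x z
  have hr := continuous_radius_middle x z
  refine Continuous.congr (f := fun y =>
    z / 2 * (z * rodPotential x y z) - y * (y * rodPotential x y z) / 2
      + x * z * rodPotential z x y - z * (y * solidAngle y x z) - x * radius x y z / 2)
    (by fun_prop) fun y => ?_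
  rw [plateEnergy]
  ring

lemma continuous_newellFunction_middle (hx : x ≠ 0) :
    Continuous fun y => newellFunction x y z := by
  have hA := continuous_mul_mul_rodPotential x z
  have hA' := continuous_const_mul_rodPotential x z
  have hB := continuous_rodPotential_first (z := z) hx
  have hC := continuous_rodPotential_last (x := z) hx
  have hα := continuous_solidAngle_middle x z
  have hβ := continuous_mul_solidAngle x z
  have hγ := continuous_solidAngle_last z x
  have hr := continuous_radius_middle x z
  refine Continuous.congr (f := fun y =>
    y * z / 2 * (z * rodPotential x y z) - y / 6 * (y * (y * rodPotential x y z))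
      + x * (3 * z ^ 2 - x ^ 2) / 6 * rodPotential y x z + x * y * z * rodPotential z x y
      - y * z / 2 * (y * solidAngle y x z) - z ^ 3 / 6 * solidAngle z x y
      - x ^ 2 * z / 2 * solidAngle x y z - x * y * radius x y z / 3) (by fun_prop) fun y => ?_
  rw [newellFunction]
  ring

lemma continuous_cubeEnergy_middle (hx : x ≠ 0) : Continuous fun y => cubeEnergy x y z := by
  have hA := continuous_mul_mul_rodPotential x z
  have hA' := continuous_const_mul_rodPotential x z
  have hB := continuous_rodPotential_first (z := z) hx
  have hC := continuous_rodPotential_last (x := z) hx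
  have hα := continuous_solidAngle_middle x z
  have hβ := continuous_mul_solidAngle x z
  have hγ := continuous_solidAngle_last z x
  have hr := continuous_radius_middle x z
  refine Continuous.congr (f := fun y =>
    (6 * y ^ 2 * z - z ^ 3) / 24 * (z * rodPotential x y z)
      - y ^ 2 / 24 * (y * (y * rodPotential x y z))
      + x * y * (3 * z ^ 2 - x ^ 2) / 6 * rodPotential y x z
      + x * z * (3 * y ^ 2 - x ^ 2) / 6 * rodPotential z x y
      - y ^ 2 * z / 6 * (y * solidAngle y x z) - y * z ^ 3 / 6 * solidAngle z x y
      - x ^ 2 * y * z / 2 * solidAngle x y z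
      + x * radius x y z * (2 * x ^ 2 - 3 * y ^ 2 - 3 * z ^ 2) / 24) (by fun_prop) fun y => ?_
  rw [cubeEnergy]
  ring

lemma isSecondPrimitive_rodPotential (h : 0 < y ^ 2 + z ^ 2) (a : ℝ) :
    IsSecondPrimitive (fun x => -rodPotential x y z) (fun x => -(1 / radius x y z))
      (fun x => x / radius x y z ^ 3) a := by
  have hr : ∀ x, radius x y z ≠ 0 := fun x => (radius_pos h).ne'
  have hinner : ∀ x, HasDerivAt (fun x => -(1 / radius x y z)) (x / radius x y z ^ 3) x := by
    intro x
    simp only [one_div]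
    refine ((hasDerivAt_radius_first (radius_pos h)).inv (hr x)).neg.congr_deriv ?_
    field_simp [hr x]
  have houter : ∀ x, HasDerivAt (fun x => -rodPotential x y z) (-(1 / radius x y z)) x :=
    fun x => (hasDerivAt_rodPotential_first h).neg
  have hcont : Continuous fun x => radius x y z := by unfold radius; fun_prop
  exact
    { continuous := continuous_iff_continuousAt.2 fun x => (houter x).continuousAt
      continuous_deriv := continuous_iff_continuousAt.2 fun x => (hinner x).continuousAt
      continuous_deriv_deriv := continuous_id.div (hcont.pow 3) fun x => pow_ne_zero 3 (hr x)
      hasDerivAt := fun x _ => houter x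
      hasDerivAt_deriv := fun x _ => hinner x }

lemma isSecondPrimitive_plateEnergy (x : ℝ) (hy : y ≠ 0) (a : ℝ) :
    IsSecondPrimitive (plateEnergy x y) (platePotential x y) (rodPotential x y) a where
  continuous := continuous_iff_continuousAt.2 fun _ => (hasDerivAt_plateEnergy hy).continuousAt
  continuous_deriv :=
    continuous_iff_continuousAt.2 fun _ => (hasDerivAt_platePotential hy).continuousAt
  continuous_deriv_deriv := continuous_rodPotential_last hy
  hasDerivAt _ _ := hasDerivAt_plateEnergy hy
  hasDerivAt_deriv _ _ := hasDerivAt_platePotential hy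

lemma isSecondPrimitive_cubeEnergy (hx : x ≠ 0) (z : ℝ) :
    IsSecondPrimitive (cubeEnergy x · z) (newellFunction x · z) (plateEnergy x · z) 0 where
  continuous := continuous_cubeEnergy_middle hx
  continuous_deriv := continuous_newellFunction_middle hx
  continuous_deriv_deriv := continuous_plateEnergy_middle hx
  hasDerivAt _ hy := hasDerivAt_cubeEnergy hx hy
  hasDerivAt_deriv _ hy := hasDerivAt_newellFunction hx hy

/-! ### Parity and special values -/

lemma rodPotential_zero (y z : ℝ) : rodPotential 0 y z = 0 := by
  rw [rodPotential, zero_div, arsinh_zero]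

lemma rodPotential_neg_first (x y z : ℝ) : rodPotential (-x) y z = -rodPotential x y z := by
  rw [rodPotential, rodPotential, neg_div, arsinh_neg]

lemma rodPotential_neg_middle (x y z : ℝ) : rodPotential x (-y) z = rodPotential x y z := by
  rw [rodPotential, rodPotential, neg_sq]

lemma rodPotential_neg_last (x y z : ℝ) : rodPotential x y (-z) = rodPotential x y z := by
  rw [rodPotential, rodPotential, neg_sq]

lemma radius_neg_first (x y z : ℝ) : radius (-x) y z = radius x y z := by
  rw [radius, radius, neg_sq]

lemma radius_neg_middle (x y z : ℝ) : radius x (-y) z = radius x y z := by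
  rw [radius, radius, neg_sq]

lemma radius_neg_last (x y z : ℝ) : radius x y (-z) = radius x y z := by
  rw [radius, radius, neg_sq]

lemma solidAngle_neg_first (x y z : ℝ) : solidAngle (-x) y z = -solidAngle x y z := by
  rw [solidAngle, solidAngle, radius_neg_first, neg_mul, div_neg, arctan_neg]

lemma solidAngle_neg_middle (x y z : ℝ) : solidAngle x (-y) z = -solidAngle x y z := by
  rw [solidAngle, solidAngle, radius_neg_middle, neg_mul, neg_div, arctan_neg]

lemma solidAngle_neg_last (x y z : ℝ) : solidAngle x y (-z) = -solidAngle x y z := by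
  rw [solidAngle, solidAngle, radius_neg_last, mul_neg, neg_div, arctan_neg]

lemma plateEnergy_even (x y : ℝ) : Function.Even (plateEnergy x y) := fun z => by
  simp only [plateEnergy, rodPotential_neg_first, rodPotential_neg_last, solidAngle_neg_last,
    radius_neg_last]
  ring

lemma cubeEnergy_even (x z : ℝ) : Function.Even (cubeEnergy x · z) := fun y => by
  simp only [cubeEnergy, rodPotential_neg_first, rodPotential_neg_middle, rodPotential_neg_last,
    solidAngle_neg_first, solidAngle_neg_middle, solidAngle_neg_last, radius_neg_middle]
  ring

lemma cubeEnergy_swap (x y z : ℝ) : cubeEnergy x z y = cubeEnergy x y z := by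
  simp only [cubeEnergy, rodPotential_swap x y z, solidAngle_swap x y z, radius_swap_right x y z]
  ring

lemma rodPotential_eq_log (h : 0 < y ^ 2 + z ^ 2) (x : ℝ) :
    rodPotential x y z = log (x + radius x y z) - log (y ^ 2 + z ^ 2) / 2 := by
  have hs : 0 < √(y ^ 2 + z ^ 2) := sqrt_pos.2 h
  have hpos := exp_arsinh (x / √(y ^ 2 + z ^ 2)) ▸ exp_pos _
  rw [← log_sqrt h.le, eq_sub_iff_add_eq, rodPotential, arsinh, radius_eq_sqrt_mul_sqrt h,
    ← log_mul hpos.ne' hs.ne']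
  congr 1
  field_simp

lemma cubeEnergy_zero_right (x y : ℝ) :
    cubeEnergy x y 0 = -(y ^ 4 / 24 * rodPotential x y 0) - x ^ 3 * y / 6 * rodPotential y x 0
      + x * radius x y 0 * (2 * x ^ 2 - 3 * y ^ 2) / 24 := by
  rw [cubeEnergy]
  ring

lemma cubeEnergy_zero_zero (hx : 0 ≤ x) : cubeEnergy x 0 0 = x ^ 4 / 12 := by
  have hr : radius x 0 0 = x := by simp [radius, sqrt_sq hx]
  rw [cubeEnergy_zero_right, hr]
  ring

lemma cubeEnergy_one_one_zero :
    cubeEnergy 1 1 0 = -(5 / 24 * log (1 + √2)) - √2 / 24 := by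
  have hr : radius 1 1 0 = √2 := by norm_num [radius]
  rw [cubeEnergy_zero_right, rodPotential_eq_log (by norm_num), hr]
  norm_num
  ring

lemma cubeEnergy_two_one_zero :
    cubeEnergy 2 1 0
      = -(log (2 + √5) / 24) - 4 / 3 * (log (1 + √5) - log 2) + 5 * √5 / 12 := by
  have hr : radius 2 1 0 = √5 := by norm_num [radius]
  have hlog : log (2 ^ 2 : ℝ) = 2 * log 2 := log_pow 2 2
  rw [cubeEnergy_zero_right, rodPotential_eq_log (by norm_num), rodPotential_eq_log (by norm_num),
    radius_swap 2 1 0, hr, zero_pow two_ne_zero, add_zero, add_zero, hlog]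
  norm_num
  ring

lemma cubeEnergy_one_one_one :
    cubeEnergy 1 1 1
      = 5 / 6 * (log (1 + √3) - log 2 / 2) - 5 * π / 36 - √3 / 6 := by
  have hr : radius 1 1 1 = √3 := by norm_num [radius]
  have hrod : rodPotential 1 1 1 = log (1 + √3) - log 2 / 2 := by
    rw [rodPotential_eq_log (by norm_num), hr]
    norm_num
  have hangle : solidAngle 1 1 1 = π / 6 := by
    rw [solidAngle, hr, one_mul, one_mul, ← tan_pi_div_six]
    exact arctan_tan (by linarith [pi_pos]) (by linarith [pi_pos])
  rw [cubeEnergy, hr, hrod, hangle]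
  ring

lemma cubeEnergy_two_one_one :
    cubeEnergy 2 1 1
      = (log (2 + √6) - log 2 / 2) / 6 - 2 / 3 * (log (1 + √6) - log 5 / 2)
        - arctan (2 / √6) / 3 - 2 * arctan (1 / (2 * √6)) + √6 / 6 := by
  have hr : radius 2 1 1 = √6 := by norm_num [radius]
  have hr' : radius 1 2 1 = √6 := by rw [radius_swap, hr]
  have hrod : rodPotential 2 1 1 = log (2 + √6) - log 2 / 2 := by
    rw [rodPotential_eq_log (by norm_num), hr]
    norm_num
  have hrod' : rodPotential 1 2 1 = log (1 + √6) - log 5 / 2 := by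
    rw [rodPotential_eq_log (by norm_num), hr']
    norm_num
  have hangle : solidAngle 2 1 1 = arctan (1 / (2 * √6)) := by rw [solidAngle, hr, one_mul]
  have hangle' : solidAngle 1 2 1 = arctan (2 / √6) := by
    rw [solidAngle, hr', one_mul, mul_one]
  rw [cubeEnergy, hr, hrod, hrod', hangle, hangle']
  ring

/-! ### Triple second difference -/

/-- The second difference in `x`, with step `1` about `x = 1`, of `-Φ`, for `Φ` vanishing at
`x = 0`. -/
def axialDiff (Φ : ℝ → ℝ → ℝ → ℝ) (y z : ℝ) : ℝ := 2 * Φ 1 y z - Φ 2 y z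

/-- The second difference in `z`, with step `1` about `z = 0`, of `axialDiff Φ`, for `Φ` even
in `z`. -/
def lateralDiff (Φ : ℝ → ℝ → ℝ → ℝ) (y : ℝ) : ℝ := 2 * (axialDiff Φ y 1 - axialDiff Φ y 0)

lemma second_difference_neg_rodPotential (y z : ℝ) :
    -rodPotential (1 + 1) y z - 2 * -rodPotential 1 y z + -rodPotential (1 - 1) y z
      = axialDiff rodPotential y z := by
  rw [sub_self, rodPotential_zero, one_add_one_eq_two, axialDiff]
  ring

lemma div_radius_pow_nonneg (hx : 0 ≤ x) : 0 ≤ x / radius x y z ^ 3 :=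
  div_nonneg hx (pow_nonneg (sqrt_nonneg _) 3)

lemma lintegral_tent_mul_div_radius_pow (h : 0 < y ^ 2 + z ^ 2) :
    ∫⁻ x, ENNReal.ofReal (1 - |x - 1|) * ENNReal.ofReal (x / radius x y z ^ 3)
      = ENNReal.ofReal (axialDiff rodPotential y z) := by
  rw [← second_difference_neg_rodPotential]
  exact (isSecondPrimitive_rodPotential h 1).lintegral_tent_mul zero_le_one fun x hx _ =>
    div_radius_pow_nonneg (by linarith [hx.1])

lemma axialDiff_rodPotential_nonneg (h : 0 < y ^ 2 + z ^ 2) : 0 ≤ axialDiff rodPotential y z := by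
  rw [← second_difference_neg_rodPotential]
  exact (isSecondPrimitive_rodPotential h 1).second_difference_nonneg zero_le_one fun x hx _ =>
    div_radius_pow_nonneg (by linarith [hx.1])

lemma isSecondPrimitive_axialDiff_plateEnergy (hy : y ≠ 0) :
    IsSecondPrimitive (axialDiff plateEnergy y) (axialDiff platePotential y)
      (axialDiff rodPotential y) 0 :=
  ((isSecondPrimitive_plateEnergy 1 hy 0).const_mul 2).sub
    (isSecondPrimitive_plateEnergy 2 hy 0)

lemma axialDiff_plateEnergy_even (y : ℝ) : Function.Even (axialDiff plateEnergy y) := fun z => by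
  simp only [axialDiff, plateEnergy_even _ y z]

lemma lintegral_tent_mul_axialDiff_rodPotential (hy : y ≠ 0) :
    ∫⁻ z, ENNReal.ofReal (1 - |z|) * ENNReal.ofReal (axialDiff rodPotential y z)
      = ENNReal.ofReal (lateralDiff plateEnergy y) :=
  (isSecondPrimitive_axialDiff_plateEnergy hy).lintegral_tent_mul_of_even
    (axialDiff_plateEnergy_even y) fun _ _ => axialDiff_rodPotential_nonneg (by positivity)

lemma lateralDiff_plateEnergy_nonneg (hy : y ≠ 0) :
    0 ≤ lateralDiff plateEnergy y :=
  (isSecondPrimitive_axialDiff_plateEnergy hy).two_mul_sub_nonneg_of_even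
    (axialDiff_plateEnergy_even y) fun _ _ => axialDiff_rodPotential_nonneg (by positivity)

lemma isSecondPrimitive_axialDiff_cubeEnergy (z : ℝ) :
    IsSecondPrimitive (axialDiff cubeEnergy · z) (axialDiff newellFunction · z)
      (axialDiff plateEnergy · z) 0 :=
  ((isSecondPrimitive_cubeEnergy one_ne_zero z).const_mul 2).sub
    (isSecondPrimitive_cubeEnergy two_ne_zero z)

lemma axialDiff_cubeEnergy_even (z : ℝ) : Function.Even (axialDiff cubeEnergy · z) := fun y => by
  simp only [axialDiff, cubeEnergy_even _ z y]

lemma isSecondPrimitive_lateralDiff_cubeEnergy :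
    IsSecondPrimitive (lateralDiff cubeEnergy) (lateralDiff newellFunction)
      (lateralDiff plateEnergy) 0 :=
  ((isSecondPrimitive_axialDiff_cubeEnergy 1).sub
    (isSecondPrimitive_axialDiff_cubeEnergy 0)).const_mul 2

lemma lateralDiff_cubeEnergy_even : Function.Even (lateralDiff cubeEnergy) := fun y => by
  simp only [lateralDiff, axialDiff_cubeEnergy_even _ y]

lemma two_mul_lateralDiff_cubeEnergy_sub :
    2 * (lateralDiff cubeEnergy 1 - lateralDiff cubeEnergy 0) = closedForm := by
  simp only [lateralDiff, axialDiff, cubeEnergy_swap _ 1 0, cubeEnergy_zero_zero zero_le_one,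
    cubeEnergy_zero_zero zero_le_two, cubeEnergy_one_one_zero, cubeEnergy_two_one_zero,
    cubeEnergy_one_one_one, cubeEnergy_two_one_one, closedForm]
  ring

/-! ### Fornberg's closed form -/

lemma log_two_add_sqrt_five : log (2 + √5) = 3 * log (1 + √5) - 3 * log 2 := by
  have hsq : √5 ^ 2 = 5 := sq_sqrt (by norm_num)
  have hcube : 2 + √5 = ((1 + √5) / 2) ^ 3 := by linear_combination (-3 / 8 - √5 / 8) * hsq
  rw [hcube, log_pow, log_div (by positivity) two_ne_zero]
  push_cast
  ring

lemma log_four_add_sqrt_six : log (4 + √6) = log 5 + log (2 + √6) - log (1 + √6) := by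
  have hsq : √6 ^ 2 = 6 := sq_sqrt (by norm_num)
  have hmul : (1 + √6) * (4 + √6) = 5 * (2 + √6) := by linear_combination hsq
  have hlog := congrArg log hmul
  rw [log_mul (by positivity) (by positivity), log_mul (by positivity) (by positivity)] at hlog
  linarith

lemma arctan_two_mul_sqrt_six : arctan (2 * √6) = π / 2 - arctan (1 / (2 * √6)) := by
  rw [one_div, arctan_inv_of_pos (by positivity), sub_sub_cancel]

lemma arctan_two_div_sqrt_six : arctan (2 / √6) = π / 4 - arctan (1 / (2 * √6)) / 2 := by
  have hsq : √6 ^ 2 = 6 := sq_sqrt (by norm_num)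
  have hpos : 0 < √6 := by positivity
  have hlt : 2 / √6 < 1 := (div_lt_one hpos).2 (lt_sqrt_of_sq_lt (by norm_num))
  have htwo : 2 * arctan (2 / √6) = arctan (2 * √6) := by
    rw [two_mul_arctan (neg_one_lt_zero.trans (by positivity)) hlt]
    congr 1
    rw [div_pow, hsq]
    field_simp
    norm_num
  rw [arctan_two_mul_sqrt_six] at htwo
  linarith

lemma closedForm_eq_fornbergForm : closedForm = fornbergForm := by
  rw [closedForm, fornbergForm, log_two_add_sqrt_five, log_four_add_sqrt_six,
    arctan_two_mul_sqrt_six, arctan_two_div_sqrt_six]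
  ring

/-! ### Reduction to the overlap volume -/

lemma setLIntegral_setLIntegral_sub {G : Type*} [AddCommGroup G] [MeasurableSpace G]
    [MeasurableAdd₂ G] [MeasurableNeg G] {μ : Measure G} [SFinite μ] [μ.IsAddLeftInvariant]
    [μ.IsNegInvariant] {A B : Set G} (hA : MeasurableSet A) (hB : MeasurableSet B)
    {k : G → ENNReal} (hk : Measurable k) :
    ∫⁻ x in A, ∫⁻ y in B, k (x - y) ∂μ ∂μ = ∫⁻ t, k t * μ (A ∩ {x | x - t ∈ B}) ∂μ := by
  have hinter : ∀ t, MeasurableSet (A ∩ {x | x - t ∈ B}) := fun t =>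
    hA.inter (measurable_id.sub_const t hB)
  calc ∫⁻ x in A, ∫⁻ y in B, k (x - y) ∂μ ∂μ
      = ∫⁻ x, A.indicator 1 x * ∫⁻ y, B.indicator 1 y * k (x - y) ∂μ ∂μ := by
        simp only [← lintegral_indicator hA, ← lintegral_indicator hB]
        refine lintegral_congr fun x => ?_
        by_cases hx : x ∈ A
        · simp only [indicator_of_mem hx, Pi.one_apply, one_mul]
          refine lintegral_congr fun y => ?_
          by_cases hy : y ∈ B <;> simp [hy]
        · simp [hx]
    _ = ∫⁻ x, ∫⁻ t, A.indicator 1 x * (B.indicator 1 (x - t) * k t) ∂μ ∂μ := by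
        refine lintegral_congr fun x => ?_
        rw [← lintegral_sub_left_eq_self _ x]
        simp only [sub_sub_cancel]
        rw [lintegral_const_mul _ (by fun_prop)]
    _ = ∫⁻ t, ∫⁻ x, A.indicator 1 x * (B.indicator 1 (x - t) * k t) ∂μ ∂μ :=
        lintegral_lintegral_swap (by unfold Function.uncurry; fun_prop)
    _ = ∫⁻ t, k t * μ (A ∩ {x | x - t ∈ B}) ∂μ := by
        refine lintegral_congr fun t => ?_
        rw [← lintegral_indicator_one (hinter t),
          ← lintegral_const_mul _ (measurable_one.indicator (hinter t))]
        refine lintegral_congr fun x => ?_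
        rw [inter_indicator_one]
        by_cases hx : x ∈ A <;> by_cases ht : x - t ∈ B <;> simp [hx, ht]

lemma volume_Icc_inter_translate {ι : Type*} [Fintype ι] (a b h t : ι → ℝ) :
    volume (Icc a (a + h) ∩ {x | x - t ∈ Icc b (b + h)})
      = ∏ i, ENNReal.ofReal (h i - |t i - (a i - b i)|) := by
  have htranslate : {x | x - t ∈ Icc b (b + h)} = Icc (b + t) (b + t + h) := by
    ext x
    simp only [mem_ofPred_eq, mem_Icc, le_sub_iff_add_le, sub_le_iff_le_add, add_right_comm b t]
  rw [htranslate, Icc_inter_Icc, volume_Icc_pi]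
  refine Finset.prod_congr rfl fun i _ => congrArg ENNReal.ofReal ?_
  calc min (a i + h i) (b i + t i + h i) - max (a i) (b i + t i)
      = h i - (max (a i) (b i + t i) - min (a i) (b i + t i)) := by
        rw [min_add_add_right]
        ring
    _ = h i - |t i - (a i - b i)| := by
        rw [max_sub_min_eq_abs]
        ring_nf

lemma volume_cubeRight_inter_translate (t : Fin 3 → ℝ) :
    volume (cubeRight ∩ {x | x - t ∈ cubeLeft})
      = ENNReal.ofReal (1 - |t 0 - 1|) * ENNReal.ofReal (1 - |t 1|)
        * ENNReal.ofReal (1 - |t 2|) := by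
  have hright : cubeRight = Icc ![1, 0, 0] (![1, 0, 0] + 1) := by
    rw [cubeRight]
    congr
    ext i
    fin_cases i <;> norm_num
  have hleft : cubeLeft = Icc 0 (0 + 1) := by
    rw [cubeLeft]
    congr <;> (ext i; fin_cases i <;> norm_num)
  rw [hright, hleft, volume_Icc_inter_translate, Fin.prod_univ_three]
  simp

lemma lintegral_fin_three {f : ℝ → ℝ → ℝ → ENNReal}
    (hf : Measurable fun p : ℝ × ℝ × ℝ => f p.1 p.2.1 p.2.2) :
    ∫⁻ t : Fin 3 → ℝ, f (t 0) (t 1) (t 2) = ∫⁻ y, ∫⁻ z, ∫⁻ x, f x y z := by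
  have hsplit := volume_preserving_piFinSuccAbove (fun _ : Fin 3 => ℝ) 0
  have hpair := (MeasurePreserving.id (volume : Measure ℝ)).prod (volume_preserving_finTwoArrow ℝ)
  calc ∫⁻ t : Fin 3 → ℝ, f (t 0) (t 1) (t 2)
      = ∫⁻ p : ℝ × ℝ × ℝ, f p.1 p.2.1 p.2.2 := (hpair.comp hsplit).lintegral_comp hf
    _ = ∫⁻ q : ℝ × ℝ, ∫⁻ x, f x q.1 q.2 := by
        rw [Measure.volume_eq_prod, lintegral_prod_symm' _ hf]
    _ = ∫⁻ y, ∫⁻ z, ∫⁻ x, f x y z := by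
        rw [Measure.volume_eq_prod, lintegral_prod _ (by fun_prop)]

lemma forceKernel_zero_eq (x y : Fin 3 → ℝ) :
    forceKernel 0 x y = (x - y) 0 / radius ((x - y) 0) ((x - y) 1) ((x - y) 2) ^ 3 := by
  rw [forceKernel, radius, sqrt_eq_rpow, ← rpow_mul_natCast (by positivity)]
  norm_num

lemma measurable_forceKernel (j : Fin 3) :
    Measurable fun p : (Fin 3 → ℝ) × (Fin 3 → ℝ) => forceKernel j p.1 p.2 := by
  unfold forceKernel
  fun_prop

lemma setLIntegral_setLIntegral_forceKernel :
    ∫⁻ x in cubeRight, ∫⁻ y in cubeLeft, ENNReal.ofReal (forceKernel 0 x y)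
      = ∫⁻ y, ∫⁻ z, ∫⁻ x, ENNReal.ofReal (1 - |y|) * (ENNReal.ofReal (1 - |z|)
        * (ENNReal.ofReal (1 - |x - 1|) * ENNReal.ofReal (x / radius x y z ^ 3))) := by
  have hk : Measurable fun t : Fin 3 → ℝ =>
      ENNReal.ofReal (t 0 / radius (t 0) (t 1) (t 2) ^ 3) := by
    unfold radius
    fun_prop
  simp only [forceKernel_zero_eq]
  rw [setLIntegral_setLIntegral_sub (A := cubeRight) (B := cubeLeft) measurableSet_Icc
    measurableSet_Icc hk, ← lintegral_fin_three (by unfold radius; fun_prop)]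
  refine lintegral_congr fun t => ?_
  rw [volume_cubeRight_inter_translate]
  ring

lemma setLIntegral_setLIntegral_forceKernel_eq_closedForm :
    ∫⁻ x in cubeRight, ∫⁻ y in cubeLeft, ENNReal.ofReal (forceKernel 0 x y)
      = ENNReal.ofReal closedForm := by
  have hinner : ∀ y ≠ 0, ∫⁻ z, ∫⁻ x, ENNReal.ofReal (1 - |y|) * (ENNReal.ofReal (1 - |z|)
        * (ENNReal.ofReal (1 - |x - 1|) * ENNReal.ofReal (x / radius x y z ^ 3)))
      = ENNReal.ofReal (1 - |y|) * ENNReal.ofReal (lateralDiff plateEnergy y) := by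
    intro y hy
    simp only [lintegral_const_mul' _ _ ENNReal.ofReal_ne_top]
    rw [← lintegral_tent_mul_axialDiff_rodPotential hy]
    refine congrArg _ (lintegral_congr fun z => ?_)
    rw [lintegral_tent_mul_div_radius_pow (by positivity)]
  rw [setLIntegral_setLIntegral_forceKernel,
    lintegral_congr_ae ((Measure.ae_ne volume 0).mono hinner),
    ← two_mul_lateralDiff_cubeEnergy_sub]
  exact isSecondPrimitive_lateralDiff_cubeEnergy.lintegral_tent_mul_of_even
    lateralDiff_cubeEnergy_even fun _ => lateralDiff_plateEnergy_nonneg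

lemma closedForm_nonneg : 0 ≤ closedForm := by
  rw [← two_mul_lateralDiff_cubeEnergy_sub]
  exact isSecondPrimitive_lateralDiff_cubeEnergy.two_mul_sub_nonneg_of_even
    lateralDiff_cubeEnergy_even fun _ => lateralDiff_plateEnergy_nonneg

lemma forceKernel_nonneg {x y : Fin 3 → ℝ} (hx : x ∈ cubeRight) (hy : y ∈ cubeLeft) :
    0 ≤ forceKernel 0 x y := by
  have hx₀ : (1 : ℝ) ≤ x 0 := by simpa using hx.1 0
  have hy₀ : y 0 ≤ (1 : ℝ) := by simpa using hy.2 0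
  have hsep : 0 ≤ x 0 - y 0 := by linarith
  unfold forceKernel
  positivity

lemma forceKernel_nonneg_ae :
    0 ≤ᵐ[volume.restrict (cubeRight ×ˢ cubeLeft)]
      fun p : (Fin 3 → ℝ) × (Fin 3 → ℝ) => forceKernel 0 p.1 p.2 :=
  (ae_restrict_iff' (measurableSet_Icc.prod measurableSet_Icc)).2
    (ae_of_all _ fun _ hp => forceKernel_nonneg hp.1 hp.2)

lemma lintegral_prod_forceKernel :
    ∫⁻ p in cubeRight ×ˢ cubeLeft, ENNReal.ofReal (forceKernel 0 p.1 p.2)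
      = ENNReal.ofReal closedForm := by
  rw [← setLIntegral_setLIntegral_forceKernel_eq_closedForm, Measure.volume_eq_prod,
    ← Measure.prod_restrict,
    lintegral_prod _ (measurable_forceKernel 0).ennreal_ofReal.aemeasurable]

lemma integrableOn_forceKernel :
    IntegrableOn (fun p : (Fin 3 → ℝ) × (Fin 3 → ℝ) => forceKernel 0 p.1 p.2)
      (cubeRight ×ˢ cubeLeft) := by
  refine ⟨(measurable_forceKernel 0).aestronglyMeasurable, ?_⟩
  rw [hasFiniteIntegral_iff_ofReal forceKernel_nonneg_ae, lintegral_prod_forceKernel]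
  exact ENNReal.ofReal_lt_top

lemma twoCubesForce_eq_closedForm : twoCubesForce = closedForm := by
  rw [twoCubesForce, forceComponent, ← setIntegral_prod (fun p => forceKernel 0 p.1 p.2)
    integrableOn_forceKernel, ← Measure.volume_eq_prod,
    integral_eq_lintegral_of_nonneg_ae forceKernel_nonneg_ae
      (measurable_forceKernel 0).aestronglyMeasurable, lintegral_prod_forceKernel,
    ENNReal.toReal_ofReal closedForm_nonneg]

end TwoCubes

end

theorem mainTheorem2 :
    MeasureTheory.IntegrableOn
        (fun p : (Fin 3 → ℝ) × (Fin 3 → ℝ) => TwoCubes.forceKernel 0 p.1 p.2)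
        (TwoCubes.cubeRight ×ˢ TwoCubes.cubeLeft) ∧
      TwoCubes.twoCubesForce = TwoCubes.closedForm ∧
      TwoCubes.closedForm = TwoCubes.fornbergForm :=
  ⟨TwoCubes.integrableOn_forceKernel, TwoCubes.twoCubesForce_eq_closedForm,
    TwoCubes.closedForm_eq_fornbergForm⟩
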